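/- Let $M$ be a loopless matroid of rank $n+1$ (with $n \ge 0$) on a finite ground set $E$, and let $\psi \colon E \to E$ be a matroid automorphism, i.e. a bijection such that $F$ is a flat of $M$ if and only if $\psi(F)$ is a flat of $M$. For $S \subseteq E$ let $v_S \in \mathbf{R}^E/\mathbf{R}\mathbf{1}$ be the class of the indicator vector of $S$, where $\mathbf{1} = (1,\dots,1)$. The (projective) matroid fan $\Sigma_M$ consists of the cones in $\mathbf{R}^E/\mathbf{R}\mathbf{1}$ generated by $v_{F_1}, \dots, v_{F_l}$, one for each chain of flats $E \supsetneq F_1 \supsetneq \dots \supsetneq F_l \supsetneq \emptyset$ with $l \ge 0$. For $p \ge 0$ let $\mathbf{F}_p(\Sigma_M) \subseteq \bigwedge^p(\mathbf{R}^E/\mathbf{R}\mathbf{1})$ be the linear subspace spanned by the wedge products of $p$ vectors contained in a common cone of $\Sigma_M$. The linear map $\Psi$ of $\mathbf{R}^E/\mathbf{R}\mathbf{1}$ given by $\Psi(v_S) = v_{\psi(S)}$ for all $S \subseteq E$ permutes the cones of $\Sigma_M$, so that $\bigwedge^p \Psi$ restricts to a linear map $\Psi_* \colon \mathbf{F}_p(\Sigma_M)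 \to \mathbf{F}_p(\Sigma_M)$. Let $\operatorname{Fix}(L(M))$ be the lattice, ordered by inclusion, of all flats $F$ of $M$ with $\psi(F) = F$, and let $\mu^\psi$ be its Möbius function. Then for every $p = 0, \dots, n$, \[ (-1)^p \operatorname{Tr}(\Psi_*, \mathbf{F}_p(\Sigma_M)) = \sum_{\substack{F \in \operatorname{Fix}(L(M)) \\ \operatorname{rk} F \le p}} \mu^\psi(\emptyset, F), \] where $\operatorname{rk}$ is the rank function of $M$. -/

import Mathlib

namespace MatroidFan

/-- The ambient space `ℝ^E / ℝ𝟏` of the projective matroid fan. -/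
abbrev ProjSpace (E : Type*) : Type _ :=
  (E → ℝ) ⧸ Submodule.span ℝ {(1 : E → ℝ)}

/-- The class `v_S` in `ℝ^E / ℝ𝟏` of the indicator vector of a subset `S ⊆ E`. -/
noncomputable def indicatorVec {E : Type*} (S : Set E) : ProjSpace E :=
  Submodule.Quotient.mk (S.indicator (1 : E → ℝ))

/-- A chain of flats `E ⊋ F₁ ⊋ ⋯ ⊋ F_l ⊋ ∅` of `M`, given as the set `{F₁, …, F_l}`
(which may be empty). -/
structure IsFlatChain {E : Type*} (M : Matroid E) (C : Set (Set E)) : Prop where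
  isFlat : ∀ F ∈ C, M.IsFlat F
  ne_empty : ∀ F ∈ C, F ≠ ∅
  ne_ground : ∀ F ∈ C, F ≠ M.E
  isChain : IsChain (· ⊆ ·) C

/-- The cone in `ℝ^E / ℝ𝟏` generated by the vectors `v_F`, `F ∈ C`. -/
noncomputable def chainCone {E : Type*} (C : Set (Set E)) : PointedCone ℝ (ProjSpace E) :=
  PointedCone.hull ℝ (indicatorVec '' C)

/-- The projective matroid fan `Σ_M` (with its fine subdivision), as a collection of cones:
one cone for each chain of proper nonempty flats. -/
def matroidFan {E : Type*} (M : Matroid E) : Set (PointedCone ℝ (ProjSpace E)) :=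
  {σ | ∃ C : Set (Set E), IsFlatChain M C ∧ σ = chainCone C}

/-- The framing group `𝐅_p(Σ_M) ⊆ ⋀^p (ℝ^E / ℝ𝟏)`: the linear span of all wedges of `p` vectors
that lie in a common cone of `Σ_M`. -/
noncomputable def framingGroup {E : Type*} (M : Matroid E) (p : ℕ) :
    Submodule ℝ (⋀[ℝ]^p (ProjSpace E)) :=
  Submodule.span ℝ
    {w | ∃ σ ∈ matroidFan M, ∃ v : Fin p → ProjSpace E,
      (∀ i, v i ∈ σ) ∧ w = exteriorPower.ιMulti ℝ p v}

/-- A matroid automorphism of a matroid whose ground set is the whole type `E`: a bijection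
`ψ : E → E` such that `F` is a flat if and only if `ψ(F)` is a flat. -/
structure MatroidAut {E : Type*} (M : Matroid E) where
  toEquiv : E ≃ E
  isFlat_image_iff : ∀ F : Set E, M.IsFlat (toEquiv '' F) ↔ M.IsFlat F

/-- The linear map of `ℝ^E / ℝ𝟏` induced by the coordinate permutation `x ↦ x ∘ ψ⁻¹` of `ℝ^E`.
By `ambientMap_indicatorVec` it sends `v_S` to `v_{ψ(S)}` for all `S ⊆ E`. -/
noncomputable def ambientMap {E : Type*} (ψ : E ≃ E) : ProjSpace E →ₗ[ℝ] ProjSpace E :=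
  Submodule.mapQ _ _ (LinearMap.funLeft ℝ ℝ ψ.symm) (by
    rw [Submodule.span_singleton_le_iff_mem]
    exact Submodule.subset_span rfl)

theorem ambientMap_indicatorVec {E : Type*} (ψ : E ≃ E) (S : Set E) :
    ambientMap ψ (indicatorVec S) = indicatorVec (ψ '' S) := by
  unfold ambientMap indicatorVec
  erw [Submodule.mapQ_apply]
  congr 1
  funext e
  have h : ψ.symm e ∈ S ↔ e ∈ ψ '' S := Set.mem_image_equiv.symm
  by_cases he : ψ.symm e ∈ S
  · simp [LinearMap.funLeft_apply, Set.indicator_of_mem he, Set.indicator_of_mem (h.1 he)]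
  · simp [LinearMap.funLeft_apply, Set.indicator_of_notMem he,
      Set.indicator_of_notMem (fun h' => he (h.2 h'))]

theorem IsFlatChain.image {E : Type*} {M : Matroid E} (hE : M.E = Set.univ) (ψ : MatroidAut M)
    {C : Set (Set E)} (hC : IsFlatChain M C) :
    IsFlatChain M ((fun F : Set E => ψ.toEquiv '' F) '' C) where
  isFlat := by
    rintro _ ⟨F, hF, rfl⟩
    exact (ψ.isFlat_image_iff F).2 (hC.isFlat F hF)
  ne_empty := by
    rintro _ ⟨F, hF, rfl⟩ h
    exact hC.ne_empty F hF (Set.image_eq_empty.1 h)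
  ne_ground := by
    rintro _ ⟨F, hF, rfl⟩ h
    refine hC.ne_ground F hF ?_
    rw [hE] at h ⊢
    exact ψ.toEquiv.injective.image_injective
      (h.trans (Set.image_univ_of_surjective ψ.toEquiv.surjective).symm)
  isChain := by
    rintro _ ⟨F, hF, rfl⟩ _ ⟨G, hG, rfl⟩ hne
    have h : F ≠ G := fun h => hne (by rw [h])
    exact (hC.isChain hF hG h).imp (fun h => Set.image_mono h) (fun h => Set.image_mono h)

theorem map_chainCone {E : Type*} (ψ : E ≃ E) (C : Set (Set E)) {v : ProjSpace E}
    (hv : v ∈ chainCone C) :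
    ambientMap ψ v ∈ chainCone ((fun F : Set E => ψ '' F) '' C) := by
  have h : chainCone C ≤ (chainCone ((fun F : Set E => ψ '' F) '' C)).comap (ambientMap ψ) := by
    refine Submodule.span_le.2 ?_
    rintro _ ⟨F, hF, rfl⟩
    change ambientMap ψ (indicatorVec F) ∈ chainCone _
    rw [ambientMap_indicatorVec]
    exact Submodule.subset_span ⟨_, ⟨F, hF, rfl⟩, rfl⟩
  exact h hv

theorem map_mem_framingGroup {E : Type*} {M : Matroid E} (hE : M.E = Set.univ)
    (ψ : MatroidAut M) (p : ℕ) :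
    ∀ w ∈ framingGroup M p,
      exteriorPower.map p (ambientMap ψ.toEquiv) w ∈ framingGroup M p := by
  intro w hw
  have h : framingGroup M p ≤
      (framingGroup M p).comap (exteriorPower.map p (ambientMap ψ.toEquiv)) := by
    refine Submodule.span_le.2 ?_
    rintro _ ⟨σ, ⟨C, hC, rfl⟩, v, hv, rfl⟩
    refine Submodule.subset_span ⟨_, ⟨_, hC.image hE ψ, rfl⟩,
      ambientMap ψ.toEquiv ∘ v, fun i => map_chainCone _ _ (hv i), ?_⟩
    exact exteriorPower.map_apply_ιMulti _ _
  exact h hw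

/-- The map `Ψ_* : 𝐅_p(Σ_M) → 𝐅_p(Σ_M)`: the restriction of `⋀^p Ψ`, where `Ψ` is the linear
map of `ℝ^E / ℝ𝟏` with `Ψ(v_S) = v_{ψ(S)}`. -/
noncomputable def framingMap {E : Type*} {M : Matroid E} (hE : M.E = Set.univ)
    (ψ : MatroidAut M) (p : ℕ) : framingGroup M p →ₗ[ℝ] framingGroup M p :=
  (exteriorPower.map p (ambientMap ψ.toEquiv)).restrict (map_mem_framingGroup hE ψ p)

/-- `Fix(L(M))`: the flats `F` of `M` with `ψ(F) = F`, ordered by inclusion. -/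
abbrev FixedFlat {E : Type*} {M : Matroid E} (ψ : MatroidAut M) : Type _ :=
  {F : Set E // M.IsFlat F ∧ ψ.toEquiv '' F = F}

noncomputable instance {E : Type*} [Finite E] {M : Matroid E} (ψ : MatroidAut M) :
    Fintype (FixedFlat ψ) :=
  Fintype.ofFinite _

/-- In a loopless matroid the empty set is a flat. -/
theorem isFlat_empty {E : Type*} (M : Matroid E) [M.Loopless] : M.IsFlat ∅ := by
  have h := M.isFlat_closure ∅
  rwa [M.closure_empty, M.loops_eq_empty] at h

/-- The minimal element `∅` of `Fix(L(M))`. -/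
def emptyFlat {E : Type*} {M : Matroid E} [M.Loopless] (ψ : MatroidAut M) : FixedFlat ψ :=
  ⟨∅, isFlat_empty M, Set.image_empty _⟩

open Classical in
/-- The Möbius function `μ^ψ` of the finite poset (lattice) `Fix(L(M))`. -/
noncomputable def mobiusFix {E : Type*} [Finite E] {M : Matroid E} (ψ : MatroidAut M)
    (F G : FixedFlat ψ) : ℤ :=
  letI : LocallyFiniteOrder (FixedFlat ψ) := Fintype.toLocallyFiniteOrder
  IncidenceAlgebra.mu ℤ F G

end MatroidFan

/-! Lift everything to `⋀ ℝ^E`. For a flat `G`, `flagSpan M p G` is spanned by the wedges of `p`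
indicator vectors along flags of flats inside `G`. Two facts about these spaces carry the proof.

Decomposition: the coordinate projections to the rank `p` flats `F ⊆ G` add up to the identity of
`flagSpan M p G` (`sum_coordProj`). An automorphism fixing `G` permutes these pieces, and only the
fixed ones contribute to its trace (`flagTrace_eq_sum`).

Acyclicity: if `φ (v_G) = 1`, wedging with `v_G` and contracting with `φ` satisfy the Koszul
identity `ι_φ (v_G ∧ x) + v_G ∧ ι_φ x = x`. Hence the alternating sum of the traces in degrees `0,
…, p` collapses to one trace, that of the automorphism composed with `x ↦ ι_φ (v_G ∧ x)` in degree
`p` (`sum_range_flagTrace`).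

For nonempty `G` and `p = rk G` this map is zero, so the signed top-degree traces of the fixed flats
obey the recursion that defines `μ^ψ(∅, ·)`. For `G = E`, where `v_E = 𝟏`, and `φ` a coordinate, the
same map is the projection to `⋀(ℝ^E/ℝ𝟏)` followed by a section, so the remaining trace is that of
`Ψ_*` on `𝐅_p` (`trace_framingMap`). Comparing the two gives the formula. -/

namespace MatroidFan

/-! ### Flats, ranks and covers. -/

section Matroid

variable {E : Type*} {M : Matroid E} {F G : Set E}

theorem isFlat_inter (hF : M.IsFlat F) (hG : M.IsFlat G) : M.IsFlat (F ∩ G) := by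
  rw [Set.inter_eq_iInter]
  exact Matroid.IsFlat.iInter (by rintro (_ | _) <;> assumption)

theorem eq_of_isFlat_of_eRk_le [M.RankFinite] (hF : M.IsFlat F) (hG : M.IsFlat G) (h : F ⊆ G)
    (hr : M.eRk G ≤ M.eRk F) : F = G := by
  have := (M.isRkFinite_set F).closure_eq_closure_of_subset_of_eRk_ge_eRk h hr
  rwa [hF.closure, hG.closure] at this

theorem eRk_lt_of_isFlat [M.RankFinite] (hF : M.IsFlat F) (hG : M.IsFlat G) (h : F ⊆ G)
    (hne : F ≠ G) : M.eRk F < M.eRk G :=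
  lt_of_not_ge fun hr => hne (eq_of_isFlat_of_eRk_le hF hG h hr)

theorem eq_empty_of_eRk_eq_zero [M.Loopless] (hF : M.IsFlat F) (hr : M.eRk F = 0) : F = ∅ := by
  rw [Matroid.eRk_eq_zero_iff hF.subset_ground, M.loops_eq_empty] at hr
  exact Set.subset_empty_iff.1 hr

/-- The flats covering the flat `F` and contained in the flat `G`. -/
def flatCovers (M : Matroid E) (F G : Set E) : Set (Set E) :=
  {K | M.IsFlat K ∧ F ⊆ K ∧ K ⊆ G ∧ M.eRk K = M.eRk F + 1}

/-- The cover has to be the closure of `F ∪ {e}`: any other candidate contains this closure and has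
the same rank. -/
theorem existsUnique_mem_flatCovers [M.RankFinite] (hF : M.IsFlat F) (hG : M.IsFlat G)
    (hFG : F ⊆ G) {e : E} (heG : e ∈ G) (heF : e ∉ F) :
    ∃! K, K ∈ flatCovers M F G ∧ e ∈ K := by
  have heE : e ∈ M.E := hG.subset_ground heG
  have hr : M.eRk (M.closure (insert e F)) = M.eRk F + 1 := by
    rw [Matroid.eRk_closure_eq, Matroid.eRk_insert_eq_add_one]
    exact ⟨heE, by rwa [hF.closure]⟩
  have hsub : insert e F ⊆ M.E := Set.insert_subset heE hF.subset_ground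
  have hins : insert e F ⊆ M.closure (insert e F) := M.subset_closure _ hsub
  refine ⟨M.closure (insert e F), ⟨⟨M.isFlat_closure _, (Set.subset_insert _ _).trans hins, ?_, hr⟩,
    hins (Set.mem_insert _ _)⟩, ?_⟩
  · rw [← hG.closure]
    exact M.closure_subset_closure (Set.insert_subset heG hFG)
  · rintro K ⟨⟨hK, hFK, -, hKr⟩, heK⟩
    refine (eq_of_isFlat_of_eRk_le (M.isFlat_closure _) hK ?_ (by rw [hr, hKr])).symm
    conv_rhs => rw [← hK.closure]
    exact M.closure_subset_closure (Set.insert_subset heK hFK)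

end Matroid

/-! ### Spans of flags in `⋀ ℝ^E` and their decomposition by rank. -/

section FlagSpan

variable {E : Type*} {M : Matroid E} {F G H : Set E} {p : ℕ}

open ExteriorAlgebra (ι)

/-- The indicator vector of `S` in `ℝ^E`. -/
noncomputable def ind (S : Set E) : E → ℝ := S.indicator 1

theorem ind_apply_of_mem {S : Set E} {e : E} (h : e ∈ S) : ind S e = 1 := by
  simp [ind, h]

theorem ind_apply_of_notMem {S : Set E} {e : E} (h : e ∉ S) : ind S e = 0 := by
  simp [ind, h]

@[simp] theorem ind_empty : ind (∅ : Set E) = 0 :=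
  Set.indicator_empty _

/-- The sets `K \ F`, for `K` covering `F` inside `G`, partition `G \ F`. -/
theorem sum_flatCovers_ind_sub [Finite E] (hF : M.IsFlat F) (hG : M.IsFlat G) (hFG : F ⊆ G) :
    ∑ K ∈ (flatCovers M F G).toFinite.toFinset, (ind K - ind F) = ind G - ind F := by
  funext e
  rw [Finset.sum_apply]
  by_cases heF : e ∈ F
  · rw [Finset.sum_eq_zero]
    · simp [ind_apply_of_mem heF, ind_apply_of_mem (hFG heF)]
    · intro K hK
      rw [Set.Finite.mem_toFinset] at hK
      simp [ind_apply_of_mem heF, ind_apply_of_mem (hK.2.1 heF)]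
  by_cases heG : e ∈ G
  · obtain ⟨K, ⟨hK, heK⟩, huniq⟩ := existsUnique_mem_flatCovers hF hG hFG heG heF
    rw [Finset.sum_eq_single K]
    · simp [ind_apply_of_mem heK, ind_apply_of_mem heG]
    · intro K' hK' hne
      rw [Set.Finite.mem_toFinset] at hK'
      have : e ∉ K' := fun h => hne (huniq K' ⟨hK', h⟩)
      simp [ind_apply_of_notMem heF, ind_apply_of_notMem this]
    · intro h
      exact absurd ((Set.Finite.mem_toFinset _).2 hK) h
  · rw [Finset.sum_eq_zero]
    · simp [ind_apply_of_notMem heF, ind_apply_of_notMem heG]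
    · intro K hK
      rw [Set.Finite.mem_toFinset] at hK
      have : e ∉ K := fun h => heG (hK.2.2.1 h)
      simp [ind_apply_of_notMem heF, ind_apply_of_notMem this]

/-- The span in `⋀ ℝ^E` of the wedges of `p` indicator vectors of flats
`G ⊇ H₁ ⊇ ⋯ ⊇ H_p`. -/
noncomputable def flagSpan (M : Matroid E) :
    ℕ → Set E → Submodule ℝ (ExteriorAlgebra ℝ (E → ℝ))
  | 0, _ => Submodule.span ℝ {1}
  | p + 1, G => ⨆ H : {H : Set E // M.IsFlat H ∧ H ⊆ G},
      (flagSpan M p H.1).map (LinearMap.mulLeft ℝ (ι ℝ (ind H.1)))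

theorem ι_mul_mem_flagSpan (hH : M.IsFlat H) (hHG : H ⊆ G) {y : ExteriorAlgebra ℝ (E → ℝ)}
    (hy : y ∈ flagSpan M p H) : ι ℝ (ind H) * y ∈ flagSpan M (p + 1) G :=
  Submodule.mem_iSup_of_mem (p := fun H : {H : Set E // M.IsFlat H ∧ H ⊆ G} =>
    (flagSpan M p H.1).map (LinearMap.mulLeft ℝ (ι ℝ (ind H.1)))) ⟨H, hH, hHG⟩
    ⟨y, hy, rfl⟩

theorem one_mem_flagSpan : 1 ∈ flagSpan M 0 G :=
  Submodule.mem_span_singleton_self _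

theorem flagSpan_zero_le {N : Submodule ℝ (ExteriorAlgebra ℝ (E → ℝ))} (h : 1 ∈ N) :
    flagSpan M 0 G ≤ N :=
  (Submodule.span_singleton_le_iff_mem _ _).2 h

theorem flagSpan_succ_le {N : Submodule ℝ (ExteriorAlgebra ℝ (E → ℝ))}
    (h : ∀ H, M.IsFlat H → H ⊆ G → ∀ y ∈ flagSpan M p H, ι ℝ (ind H) * y ∈ N) :
    flagSpan M (p + 1) G ≤ N := by
  refine iSup_le fun H => ?_
  rintro _ ⟨y, hy, rfl⟩
  exact h H.1 H.2.1 H.2.2 y hy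

theorem flagSpan_mono (h : F ⊆ G) : flagSpan M p F ≤ flagSpan M p G := by
  cases p with
  | zero => exact le_rfl
  | succ p => exact flagSpan_succ_le fun H hH hHF y hy => ι_mul_mem_flagSpan hH (hHF.trans h) hy

instance [Finite E] : FiniteDimensional ℝ (flagSpan M p G) := by
  induction p generalizing G with
  | zero => exact FiniteDimensional.span_singleton ℝ _
  | succ p ih =>
    change FiniteDimensional ℝ ↥(⨆ H : {H : Set E // M.IsFlat H ∧ H ⊆ G},
      (flagSpan M p H.1).map (LinearMap.mulLeft ℝ (ι ℝ (ind H.1))))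
    infer_instance

theorem contractLeft_eq_zero_of_mem_flagSpan_zero (φ : Module.Dual ℝ (E → ℝ))
    {x : ExteriorAlgebra ℝ (E → ℝ)} (hx : x ∈ flagSpan M 0 G) :
    CliffordAlgebra.contractLeft φ x = 0 := by
  obtain ⟨c, rfl⟩ := Submodule.mem_span_singleton.1 hx
  rw [map_smul, CliffordAlgebra.contractLeft_one, smul_zero]

/-- Contraction is an antiderivation, and deleting one member of a flag leaves a flag. -/
theorem contractLeft_mem_flagSpan (φ : Module.Dual ℝ (E → ℝ))
    {x : ExteriorAlgebra ℝ (E → ℝ)} (hx : x ∈ flagSpan M (p + 1) G) :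
    CliffordAlgebra.contractLeft φ x ∈ flagSpan M p G := by
  suffices h : flagSpan M (p + 1) G ≤
      (flagSpan M p G).comap (CliffordAlgebra.contractLeft φ) from h hx
  clear hx x
  induction p generalizing G with
  | zero =>
    refine flagSpan_succ_le fun H hH hHG y hy => ?_
    rw [Submodule.mem_comap, CliffordAlgebra.contractLeft_ι_mul,
      contractLeft_eq_zero_of_mem_flagSpan_zero φ hy, mul_zero, sub_zero]
    exact Submodule.smul_mem _ _ (flagSpan_mono hHG hy)
  | succ p ih =>
    refine flagSpan_succ_le fun H hH hHG y hy => ?_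
    rw [Submodule.mem_comap, CliffordAlgebra.contractLeft_ι_mul]
    exact Submodule.sub_mem _ (Submodule.smul_mem _ _ (flagSpan_mono hHG hy))
      (ι_mul_mem_flagSpan hH hHG (ih hy))

/-- A flag with more members than `rk G` repeats a flat or contains `∅`, and its wedge vanishes
either way. -/
theorem flagSpan_eq_bot [M.Loopless] [M.RankFinite] (hG : M.IsFlat G) (h : M.eRk G < p) :
    flagSpan M p G = ⊥ := by
  induction p using Nat.strong_induction_on generalizing G with
  | _ p ih =>
    cases p with
    | zero => simp at h
    | succ p =>
      refine le_bot_iff.1 (flagSpan_succ_le fun H hH hHG y hy => ?_)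
      rw [Submodule.mem_bot]
      rcases lt_or_ge (M.eRk H) p with hlt | hge
      · rw [ih p (Nat.lt_succ_self p) hH hlt, Submodule.mem_bot] at hy
        rw [hy, mul_zero]
      have hle : M.eRk H ≤ p := by
        have := (M.eRk_mono hHG).trans_lt h
        rw [Nat.cast_succ] at this
        exact Order.le_of_lt_add_one this
      have hHp : M.eRk H = p := le_antisymm hle hge
      cases p with
      | zero => rw [eq_empty_of_eRk_eq_zero hH (by simpa using hHp), ind_empty, map_zero, zero_mul]
      | succ p =>
        -- In the critical case `rk H = p + 1`, look at the next member `K` of the flag: `K = H`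
        -- gives a square, and `K ≠ H` has rank too small for the rest of the flag.
        suffices hs : flagSpan M (p + 1) H ≤ LinearMap.ker (LinearMap.mulLeft ℝ (ι ℝ (ind H))) from
          hs hy
        refine flagSpan_succ_le fun K hK hKH z hz => ?_
        rw [LinearMap.mem_ker, LinearMap.mulLeft_apply]
        rcases eq_or_ne K H with rfl | hne
        · rw [← mul_assoc, ExteriorAlgebra.ι_sq_zero, zero_mul]
        · have hlt := eRk_lt_of_isFlat hK hH hKH hne
          rw [hHp] at hlt
          have := ι_mul_mem_flagSpan hK subset_rfl hz
          rw [ih (p + 1) (Nat.lt_succ_self _) hK hlt, Submodule.mem_bot] at this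
          rw [this, mul_zero]

/-- The flats of rank `p` contained in `G`. -/
noncomputable def flatsOfRank [Finite E] (M : Matroid E) (p : ℕ) (G : Set E) : Finset (Set E) :=
  {F | M.IsFlat F ∧ F ⊆ G ∧ M.eRk F = p}.toFinite.toFinset

theorem mem_flatsOfRank [Finite E] :
    F ∈ flatsOfRank M p G ↔ M.IsFlat F ∧ F ⊆ G ∧ M.eRk F = p := by
  simp [flatsOfRank]

/-- Inductively the tail of a flag below `H` lives on flats `F` of rank `p`. There `v_F ∧ x = 0`, so
`v_H ∧ x = (v_H - v_F) ∧ x`, which the partition of `H \ F` spreads over the covers of `F`, of rank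
`p + 1`. -/
theorem flagSpan_le_iSup [Finite E] [M.Loopless] (hG : M.IsFlat G) :
    flagSpan M p G ≤ ⨆ F ∈ flatsOfRank M p G, flagSpan M p F := by
  induction p generalizing G with
  | zero =>
    exact le_iSup₂_of_le (f := fun F (_ : F ∈ flatsOfRank M 0 G) => flagSpan M 0 F) ∅
      (mem_flatsOfRank.2 ⟨isFlat_empty M, Set.empty_subset _, by simp⟩) le_rfl
  | succ p ih =>
    refine flagSpan_succ_le fun H hH hHG y hy => ?_
    suffices hs : (⨆ F ∈ flatsOfRank M p H, flagSpan M p F) ≤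
        (⨆ F ∈ flatsOfRank M (p + 1) G, flagSpan M (p + 1) F).comap
          (LinearMap.mulLeft ℝ (ι ℝ (ind H))) from hs (ih hH hy)
    refine iSup₂_le fun F hF x hx => ?_
    obtain ⟨hF, hFH, hFr⟩ := mem_flatsOfRank.1 hF
    have h0 : ι ℝ (ind F) * x = 0 := by
      have := ι_mul_mem_flagSpan hF subset_rfl hx
      rwa [flagSpan_eq_bot hF (by rw [hFr]; exact_mod_cast Nat.lt_succ_self p),
        Submodule.mem_bot] at this
    have hsum : ι ℝ (ind H) * x =
        ∑ K ∈ (flatCovers M F H).toFinite.toFinset, ι ℝ (ind K) * x := by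
      have h := congrArg (fun v => ι ℝ v * x) (sum_flatCovers_ind_sub hF hH hFH)
      simp only [map_sum, map_sub, Finset.sum_mul, sub_mul, h0, sub_zero] at h
      exact h.symm
    rw [Submodule.mem_comap, LinearMap.mulLeft_apply, hsum]
    refine Submodule.sum_mem _ fun K hK => ?_
    obtain ⟨hK, hFK, hKH, hKr⟩ := (Set.Finite.mem_toFinset _).1 hK
    exact Submodule.mem_iSup_of_mem K (Submodule.mem_iSup_of_mem
      (mem_flatsOfRank.2 ⟨hK, hKH.trans hHG, by rw [hKr, hFr]; norm_cast⟩)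
      (ι_mul_mem_flagSpan hK subset_rfl (flagSpan_mono hFK hx)))

/-- The endomorphism of `⋀ ℝ^E` induced by the coordinate projection to `ℝ^S`. -/
noncomputable def coordProj (S : Set E) :
    ExteriorAlgebra ℝ (E → ℝ) →ₐ[ℝ] ExteriorAlgebra ℝ (E → ℝ) :=
  ExteriorAlgebra.map (LinearMap.mulLeft ℝ (ind S))

theorem coordProj_ι_ind (S : Set E) : coordProj S (ι ℝ (ind H)) = ι ℝ (ind (S ∩ H)) := by
  rw [coordProj, ExteriorAlgebra.map_apply_ι]
  congr 1
  funext e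
  by_cases h₁ : e ∈ S <;> by_cases h₂ : e ∈ H <;> simp [ind, h₁, h₂]

theorem coordProj_mem_flagSpan (hF : M.IsFlat F) {x : ExteriorAlgebra ℝ (E → ℝ)}
    (hx : x ∈ flagSpan M p G) : coordProj F x ∈ flagSpan M p (F ∩ G) := by
  suffices h : flagSpan M p G ≤ (flagSpan M p (F ∩ G)).comap (coordProj F).toLinearMap from h hx
  clear hx x
  induction p generalizing G with
  | zero => exact flagSpan_zero_le (by simpa using one_mem_flagSpan)
  | succ p ih =>
    refine flagSpan_succ_le fun H hH hHG y hy => ?_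
    rw [Submodule.mem_comap, AlgHom.toLinearMap_apply, map_mul, coordProj_ι_ind]
    exact ι_mul_mem_flagSpan (isFlat_inter hF hH) (Set.inter_subset_inter_right _ hHG) (ih hy)

theorem coordProj_eq_self {S : Set E} (hGS : G ⊆ S) {x : ExteriorAlgebra ℝ (E → ℝ)}
    (hx : x ∈ flagSpan M p G) : coordProj S x = x := by
  suffices h : flagSpan M p G ≤ LinearMap.eqLocus (coordProj S).toLinearMap LinearMap.id from h hx
  clear hx x
  induction p generalizing G with
  | zero => exact flagSpan_zero_le (by simp)
  | succ p ih =>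
    refine flagSpan_succ_le fun H hH hHG y hy => ?_
    have hy' : coordProj S y = y := ih (hHG.trans hGS) hy
    simp [coordProj_ι_ind, Set.inter_eq_right.2 (hHG.trans hGS), hy']

/-- The image lives on `F ∩ G`, a proper subflat of `F`, whose rank is below `p`. -/
theorem coordProj_eq_zero [M.Loopless] [M.RankFinite] (hF : M.IsFlat F) (hG : M.IsFlat G)
    (hFp : M.eRk F ≤ p) (hFG : ¬ F ⊆ G) {x : ExteriorAlgebra ℝ (E → ℝ)}
    (hx : x ∈ flagSpan M p G) : coordProj F x = 0 := by
  have h := coordProj_mem_flagSpan hF hx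
  rwa [flagSpan_eq_bot (isFlat_inter hF hG), Submodule.mem_bot] at h
  refine (eRk_lt_of_isFlat (isFlat_inter hF hG) hF Set.inter_subset_left ?_).trans_le hFp
  exact fun h => hFG (Set.inter_eq_left.1 h)

/-- On the piece of a rank `p` flat its own projection is the identity, while those of the other
rank `p` flats vanish. -/
theorem sum_coordProj [Finite E] [M.Loopless] (hG : M.IsFlat G)
    {x : ExteriorAlgebra ℝ (E → ℝ)} (hx : x ∈ flagSpan M p G) :
    ∑ F ∈ flatsOfRank M p G, coordProj F x = x := by
  suffices h : (⨆ F ∈ flatsOfRank M p G, flagSpan M p F) ≤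
      LinearMap.eqLocus (∑ F ∈ flatsOfRank M p G, (coordProj F).toLinearMap) LinearMap.id by
    simpa using h (flagSpan_le_iSup hG hx)
  refine iSup₂_le fun F hF x hx => ?_
  obtain ⟨hFf, hFG, hFr⟩ := mem_flatsOfRank.1 hF
  suffices h : ∑ F ∈ flatsOfRank M p G, coordProj F x = x by simpa using h
  rw [Finset.sum_eq_single_of_mem F hF, coordProj_eq_self subset_rfl hx]
  intro K hK hne
  obtain ⟨hKf, hKG, hKr⟩ := mem_flatsOfRank.1 hK
  refine coordProj_eq_zero hKf hFf hKr.le (fun h => hne ?_) hx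
  exact eq_of_isFlat_of_eRk_le hKf hFf h (by rw [hFr, hKr])

/-- The automorphism of `⋀ ℝ^E` induced by a permutation of the coordinates. -/
noncomputable def permMap (ψ : E ≃ E) :
    ExteriorAlgebra ℝ (E → ℝ) →ₐ[ℝ] ExteriorAlgebra ℝ (E → ℝ) :=
  ExteriorAlgebra.map (LinearMap.funLeft ℝ ℝ ψ.symm)

theorem permMap_ι_ind (ψ : E ≃ E) (S : Set E) :
    permMap ψ (ι ℝ (ind S)) = ι ℝ (ind (ψ '' S)) := by
  rw [permMap, ExteriorAlgebra.map_apply_ι]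
  congr 1
  funext e
  have h : ψ.symm e ∈ S ↔ e ∈ ψ '' S := Set.mem_image_equiv.symm
  rw [LinearMap.funLeft_apply]
  by_cases he : e ∈ ψ '' S
  · rw [ind_apply_of_mem he, ind_apply_of_mem (h.2 he)]
  · rw [ind_apply_of_notMem he, ind_apply_of_notMem (mt h.1 he)]

theorem permMap_mem_flagSpan (ψ : MatroidAut M) {x : ExteriorAlgebra ℝ (E → ℝ)}
    (hx : x ∈ flagSpan M p G) :
    permMap ψ.toEquiv x ∈ flagSpan M p (ψ.toEquiv '' G) := by
  suffices h : flagSpan M p G ≤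
      (flagSpan M p (ψ.toEquiv '' G)).comap (permMap ψ.toEquiv).toLinearMap from h hx
  clear hx x
  induction p generalizing G with
  | zero => exact flagSpan_zero_le (by simpa using one_mem_flagSpan)
  | succ p ih =>
    refine flagSpan_succ_le fun H hH hHG y hy => ?_
    rw [Submodule.mem_comap, AlgHom.toLinearMap_apply, map_mul, permMap_ι_ind]
    exact ι_mul_mem_flagSpan ((ψ.isFlat_image_iff H).2 hH) (Set.image_mono hHG) (ih hy)

end FlagSpan

/-! ### Traces, the Koszul homotopy and Möbius inversion. -/

section Trace

variable {E : Type*} {M : Matroid E} {F G H : Set E} {p : ℕ}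

open ExteriorAlgebra (ι)

/-- The endomorphism of `flagSpan M p G` induced by an automorphism that fixes `G`. -/
noncomputable def flagEnd (ψ : MatroidAut M) (p : ℕ) (G : FixedFlat ψ) :
    flagSpan M p G.1 →ₗ[ℝ] flagSpan M p G.1 :=
  (permMap ψ.toEquiv).toLinearMap.restrict fun x hx => by
    have := permMap_mem_flagSpan ψ hx
    rwa [G.2.2] at this

/-- The coordinate projection of `flagSpan M p G` to `flagSpan M p F`. -/
noncomputable def flagProj (M : Matroid E) (p : ℕ) (hF : M.IsFlat F) (G : Set E) :
    flagSpan M p G →ₗ[ℝ] flagSpan M p F :=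
  (coordProj F).toLinearMap.restrict fun _ hx =>
    flagSpan_mono Set.inter_subset_left (coordProj_mem_flagSpan hF hx)

/-- The trace of an automorphism on the span of the flags in a fixed flat. -/
noncomputable def flagTrace (ψ : MatroidAut M) (p : ℕ) (G : FixedFlat ψ) : ℝ :=
  LinearMap.trace ℝ _ (flagEnd ψ p G)

theorem trace_flagEnd_comp_flagProj [Finite E] (ψ : MatroidAut M) {F G : FixedFlat ψ}
    (hFG : F.1 ⊆ G.1) :
    LinearMap.trace ℝ _ (flagEnd ψ p G ∘ₗ Submodule.inclusion (flagSpan_mono hFG) ∘ₗ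
      flagProj M p F.2.1 G.1) = flagTrace ψ p F := by
  rw [← LinearMap.comp_assoc, LinearMap.trace_comp_comm', flagTrace]
  congr 1
  refine LinearMap.ext fun x => Subtype.ext ?_
  change coordProj F.1 (permMap ψ.toEquiv x) = permMap ψ.toEquiv x
  refine coordProj_eq_self subset_rfl (G := F.1) (M := M) (p := p) ?_
  have := permMap_mem_flagSpan ψ x.2
  rwa [F.2.2] at this

/-- By cyclicity this is the trace of `ψ` followed by projection to `F`. But `ψ` moves the piece of
`F` to that of `ψ(F)`, which does not contain `F`. -/
theorem trace_flagEnd_comp_flagProj_eq_zero [Finite E] [M.Loopless] (ψ : MatroidAut M)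
    {G : FixedFlat ψ} (hF : M.IsFlat F) (hFp : M.eRk F ≤ p) (hFG : F ⊆ G.1)
    (hne : ψ.toEquiv '' F ≠ F) :
    LinearMap.trace ℝ _ (flagEnd ψ p G ∘ₗ Submodule.inclusion (flagSpan_mono hFG) ∘ₗ
      flagProj M p hF G.1) = 0 := by
  rw [← LinearMap.comp_assoc, LinearMap.trace_comp_comm']
  convert map_zero (LinearMap.trace ℝ (flagSpan M p F))
  refine LinearMap.ext fun x => Subtype.ext ?_
  change coordProj F (permMap ψ.toEquiv x) = 0
  refine coordProj_eq_zero hF ((ψ.isFlat_image_iff F).2 hF) hFp (fun h => hne ?_)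
    (permMap_mem_flagSpan ψ x.2)
  refine (Set.eq_of_subset_of_ncard_le h ?_ (Set.toFinite _)).symm
  rw [Set.ncard_image_of_injective _ ψ.toEquiv.injective]

open Classical in
theorem flagTrace_eq_sum [Finite E] [M.Loopless] (ψ : MatroidAut M) (p : ℕ) (G : FixedFlat ψ) :
    flagTrace ψ p G =
      ∑ F : FixedFlat ψ with F ≤ G ∧ M.eRk F.1 = p, flagTrace ψ p F := by
  have hid : flagEnd ψ p G = ∑ F : {F // F ∈ flatsOfRank M p G.1},
      flagEnd ψ p G ∘ₗ Submodule.inclusion (flagSpan_mono (mem_flatsOfRank.1 F.2).2.1) ∘ₗ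
        flagProj M p (mem_flatsOfRank.1 F.2).1 G.1 := by
    refine LinearMap.ext fun x => ?_
    rw [LinearMap.sum_apply]
    simp only [LinearMap.comp_apply]
    rw [← map_sum]
    congr 1
    refine Subtype.ext ?_
    rw [AddSubmonoidClass.coe_finsetSum]
    refine (sum_coordProj G.2.1 x.2).symm.trans ?_
    exact (Finset.sum_coe_sort _ fun F => coordProj F (x : ExteriorAlgebra ℝ (E → ℝ))).symm
  have hmem : ∀ F ∈ Finset.univ.filter (fun F : FixedFlat ψ => F ≤ G ∧ M.eRk F.1 = p),
      F.1 ∈ flatsOfRank M p G.1 := fun F hF => by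
    obtain ⟨hFG, hFr⟩ := (Finset.mem_filter.1 hF).2
    exact mem_flatsOfRank.2 ⟨F.2.1, hFG, hFr⟩
  rw [flagTrace, hid, map_sum, ← Finset.sum_subset (Finset.subset_univ
    (Finset.univ.filter fun F : {F // F ∈ flatsOfRank M p G.1} => ψ.toEquiv '' F.1 = F.1))]
  · symm
    refine Finset.sum_bij (fun F hF => ⟨F.1, hmem F hF⟩) ?_ ?_ ?_ ?_
    · intro F hF
      exact Finset.mem_filter.2 ⟨Finset.mem_univ _, F.2.2⟩
    · intro F _ F' _ h
      exact Subtype.ext (congrArg (fun F => F.1) h)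
    · rintro ⟨F, hF⟩ h
      obtain ⟨hFf, hFG, hFr⟩ := mem_flatsOfRank.1 hF
      exact ⟨⟨F, hFf, (Finset.mem_filter.1 h).2⟩,
        Finset.mem_filter.2 ⟨Finset.mem_univ _, hFG, hFr⟩, rfl⟩
    · intro F hF
      exact (trace_flagEnd_comp_flagProj ψ (Finset.mem_filter.1 hF).2.1).symm
  · rintro ⟨F, hF⟩ - h
    obtain ⟨hFf, hFG, hFr⟩ := mem_flatsOfRank.1 hF
    refine trace_flagEnd_comp_flagProj_eq_zero ψ hFf hFr.le hFG fun hfix => h ?_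
    exact Finset.mem_filter.2 ⟨Finset.mem_univ _, hfix⟩

/-- Left multiplication by `v_G` on the spans of flags. -/
noncomputable def flagWedge (hG : M.IsFlat G) (p : ℕ) :
    flagSpan M p G →ₗ[ℝ] flagSpan M (p + 1) G :=
  (LinearMap.mulLeft ℝ (ι ℝ (ind G))).restrict fun _ hx => ι_mul_mem_flagSpan hG subset_rfl hx

/-- Contraction with a linear form on the spans of flags. -/
noncomputable def flagContract (φ : Module.Dual ℝ (E → ℝ)) (M : Matroid E) (p : ℕ) (G : Set E) :
    flagSpan M (p + 1) G →ₗ[ℝ] flagSpan M p G :=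
  (CliffordAlgebra.contractLeft φ).restrict fun _ hx => contractLeft_mem_flagSpan φ hx

theorem contractLeft_ι_mul_add {v : E → ℝ} {φ : Module.Dual ℝ (E → ℝ)} (hφ : φ v = 1)
    (x : ExteriorAlgebra ℝ (E → ℝ)) :
    CliffordAlgebra.contractLeft φ (ι ℝ v * x) +
      ι ℝ v * CliffordAlgebra.contractLeft φ x = x := by
  rw [CliffordAlgebra.contractLeft_ι_mul, hφ, one_smul, sub_add_cancel]

theorem flagEnd_flagWedge (ψ : MatroidAut M) (G : FixedFlat ψ) :
    flagEnd ψ (p + 1) G ∘ₗ flagWedge G.2.1 p = flagWedge G.2.1 p ∘ₗ flagEnd ψ p G := by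
  refine LinearMap.ext fun x => Subtype.ext ?_
  change permMap ψ.toEquiv (ι ℝ (ind G.1) * x) = ι ℝ (ind G.1) * permMap ψ.toEquiv x
  rw [map_mul, permMap_ι_ind, G.2.2]

theorem flagTrace_zero (ψ : MatroidAut M) (G : FixedFlat ψ) (φ : Module.Dual ℝ (E → ℝ))
    (hφ : φ (ind G.1) = 1) :
    flagTrace ψ 0 G = LinearMap.trace ℝ _
      (flagEnd ψ 0 G ∘ₗ flagContract φ M 0 G.1 ∘ₗ flagWedge G.2.1 0) := by
  rw [flagTrace]
  congr 1
  refine LinearMap.ext fun x => Subtype.ext ?_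
  change permMap ψ.toEquiv x =
    permMap ψ.toEquiv (CliffordAlgebra.contractLeft φ (ι ℝ (ind G.1) * x))
  have h := contractLeft_ι_mul_add hφ x.1
  rw [contractLeft_eq_zero_of_mem_flagSpan_zero φ x.2, mul_zero, add_zero] at h
  rw [h]

theorem flagTrace_succ [Finite E] (ψ : MatroidAut M) (p : ℕ) (G : FixedFlat ψ)
    (φ : Module.Dual ℝ (E → ℝ)) (hφ : φ (ind G.1) = 1) :
    flagTrace ψ (p + 1) G =
      LinearMap.trace ℝ _
        (flagEnd ψ (p + 1) G ∘ₗ flagContract φ M (p + 1) G.1 ∘ₗ flagWedge G.2.1 (p + 1)) +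
      LinearMap.trace ℝ _ (flagEnd ψ p G ∘ₗ flagContract φ M p G.1 ∘ₗ flagWedge G.2.1 p) := by
  have h : LinearMap.trace ℝ _
      (flagEnd ψ p G ∘ₗ flagContract φ M p G.1 ∘ₗ flagWedge G.2.1 p) =
      LinearMap.trace ℝ _
        (flagEnd ψ (p + 1) G ∘ₗ flagWedge G.2.1 p ∘ₗ flagContract φ M p G.1) := by
    -- Only the wedge with `v_G` has to commute with `ψ`; the form `φ` need not be invariant,
    -- because the trace is cyclic.
    rw [← LinearMap.comp_assoc, LinearMap.trace_comp_comm', ← LinearMap.comp_assoc,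
      ← LinearMap.comp_assoc, flagEnd_flagWedge]
  rw [h, ← map_add, flagTrace]
  congr 1
  refine LinearMap.ext fun x => Subtype.ext ?_
  change permMap ψ.toEquiv x =
    permMap ψ.toEquiv (CliffordAlgebra.contractLeft φ (ι ℝ (ind G.1) * x)) +
      permMap ψ.toEquiv (ι ℝ (ind G.1) * CliffordAlgebra.contractLeft φ x)
  rw [← map_add, contractLeft_ι_mul_add hφ]

/-- The Koszul identity writes each trace as a sum of two consecutive terms, so the alternating sum
telescopes. -/
theorem sum_range_flagTrace [Finite E] (ψ : MatroidAut M) (p : ℕ) (G : FixedFlat ψ)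
    (φ : Module.Dual ℝ (E → ℝ)) (hφ : φ (ind G.1) = 1) :
    ∑ q ∈ Finset.range (p + 1), (-1 : ℝ) ^ q * flagTrace ψ q G =
      (-1) ^ p * LinearMap.trace ℝ _
        (flagEnd ψ p G ∘ₗ flagContract φ M p G.1 ∘ₗ flagWedge G.2.1 p) := by
  induction p with
  | zero => simp [flagTrace_zero ψ G φ hφ]
  | succ p ih =>
    rw [Finset.sum_range_succ, ih, flagTrace_succ ψ p G φ hφ]
    ring

/-- The signed trace of an automorphism on the complete flags in a fixed flat. -/
noncomputable def signedTrace (ψ : MatroidAut M) (F : FixedFlat ψ) : ℝ :=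
  (-1) ^ (M.eRk F.1).toNat * flagTrace ψ (M.eRk F.1).toNat F

open Classical in
-- Group the fixed flats by rank and apply the decomposition of `flagTrace` in each degree.
theorem sum_signedTrace [Finite E] [M.Loopless] (ψ : MatroidAut M) (p : ℕ) (G : FixedFlat ψ) :
    ∑ F : FixedFlat ψ with F ≤ G ∧ M.eRk F.1 ≤ p, signedTrace ψ F =
      ∑ q ∈ Finset.range (p + 1), (-1 : ℝ) ^ q * flagTrace ψ q G := by
  rw [← Finset.sum_fiberwise_of_maps_to (g := fun F : FixedFlat ψ => (M.eRk F.1).toNat)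
    (t := Finset.range (p + 1))]
  · refine Finset.sum_congr rfl fun q hq => ?_
    rw [flagTrace_eq_sum, Finset.mul_sum, Finset.filter_filter]
    have hcoe (F : FixedFlat ψ) : M.eRk F.1 = ((M.eRk F.1).toNat : ℕ∞) :=
      (ENat.natCast_toNat (M.isRkFinite_set F.1).eRk_lt_top.ne).symm
    refine Finset.sum_congr (Finset.filter_congr fun F _ => ?_) fun F hF => ?_
    · rw [hcoe F, ENat.toNat_natCast, Nat.cast_inj, Nat.cast_le]
      rw [Finset.mem_range] at hq
      constructor
      · rintro ⟨⟨h, -⟩, h'⟩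
        exact ⟨h, h'⟩
      · rintro ⟨h, h'⟩
        exact ⟨⟨h, by omega⟩, h'⟩
    · rw [signedTrace, (Finset.mem_filter.1 hF).2.2, ENat.toNat_natCast]
  · intro F hF
    rw [Finset.mem_range, Nat.lt_succ_iff]
    exact ENat.toNat_le_of_le_natCast (Finset.mem_filter.1 hF).2.2

theorem signedTrace_emptyFlat [Finite E] [M.Loopless] (ψ : MatroidAut M) :
    signedTrace ψ (emptyFlat ψ) = 1 := by
  have h0 : (M.eRk (emptyFlat ψ).1).toNat = 0 := by
    change (M.eRk ∅).toNat = 0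
    simp
  rw [signedTrace, h0, pow_zero, one_mul, flagTrace]
  have hid : flagEnd ψ 0 (emptyFlat ψ) = LinearMap.id := by
    refine LinearMap.ext fun x => Subtype.ext ?_
    obtain ⟨c, hc⟩ := Submodule.mem_span_singleton.1 x.2
    change permMap ψ.toEquiv x = x
    rw [← hc, map_smul, map_one]
  rw [hid, LinearMap.trace_id]
  change ((Module.finrank ℝ (Submodule.span ℝ {(1 : ExteriorAlgebra ℝ (E → ℝ))}) : ℕ) : ℝ) = 1
  rw [finrank_span_singleton one_ne_zero, Nat.cast_one]

open Classical in
theorem sum_signedTrace_le [Finite E] [M.Loopless] (ψ : MatroidAut M) (G : FixedFlat ψ) :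
    ∑ F : FixedFlat ψ with F ≤ G, signedTrace ψ F = if emptyFlat ψ = G then 1 else 0 := by
  split_ifs with h
  · subst h
    rw [Finset.sum_eq_single_of_mem (emptyFlat ψ) (by simp), signedTrace_emptyFlat]
    intro F hF hne
    exact absurd (Subtype.ext (Set.subset_empty_iff.1 (Finset.mem_filter.1 hF).2)) hne
  · obtain ⟨e, he⟩ : G.1.Nonempty := by
      rw [Set.nonempty_iff_ne_empty]
      exact fun hG => h (Subtype.ext hG.symm)
    have hφ : (LinearMap.proj e : Module.Dual ℝ (E → ℝ)) (ind G.1) = 1 := ind_apply_of_mem he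
    obtain ⟨r, hr⟩ := ENat.ne_top_iff_exists.1 (M.isRkFinite_set G.1).eRk_lt_top.ne
    have hfilter : (Finset.univ.filter fun F : FixedFlat ψ => F ≤ G) =
        Finset.univ.filter fun F : FixedFlat ψ => F ≤ G ∧ M.eRk F.1 ≤ r := by
      refine Finset.filter_congr fun F _ => ⟨fun h => ⟨h, ?_⟩, And.left⟩
      rw [hr]
      exact M.eRk_mono h
    -- With `r = rk G`, wedging with `v_G` in degree `r` lands in degree `r + 1`, which is zero;
    -- this kills the one trace left after telescoping.
    have hbot : flagSpan M (r + 1) G.1 = ⊥ := flagSpan_eq_bot G.2.1 (by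
      rw [← hr]
      exact_mod_cast Nat.lt_succ_self r)
    have hw : flagWedge G.2.1 r = 0 := by
      refine LinearMap.ext fun x => Subtype.ext ?_
      exact (Submodule.mem_bot ℝ).1 (hbot.le (flagWedge G.2.1 r x).2)
    rw [hfilter, sum_signedTrace, sum_range_flagTrace ψ r G _ hφ, hw]
    simp

open Classical in
-- Both functions satisfy the same recursion over `[b, y]`, which determines the value at `y` from
-- those below it.
theorem eq_mu_of_sum_eq {P : Type*} [PartialOrder P] [LocallyFiniteOrder P] [Fintype P] {b : P}
    (hb : ∀ x, b ≤ x) {f : P → ℝ} (hf : ∀ y, ∑ x with x ≤ y, f x = if b = y then 1 else 0)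
    (y : P) : f y = (IncidenceAlgebra.mu ℤ b y : ℝ) := by
  induction y using WellFoundedLT.induction with
  | _ y ih =>
    have hIcc : Finset.univ.filter (fun x => x ≤ y) = Finset.Icc b y := by
      ext x
      simp [hb]
    have h₁ := hf y
    have h₂ := congrArg (Int.cast : ℤ → ℝ) (IncidenceAlgebra.sum_Icc_mu_right (𝕜 := ℤ) b y)
    rw [hIcc, ← Finset.Ico_insert_right (hb y), Finset.sum_insert Finset.right_notMem_Ico,
      Finset.sum_congr rfl fun x hx => ih x (Finset.mem_Ico.1 hx).2] at h₁
    rw [← Finset.Ico_insert_right (hb y), Finset.sum_insert Finset.right_notMem_Ico] at h₂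
    push_cast at h₂
    linarith

theorem signedTrace_eq_mobiusFix [Finite E] [M.Loopless] (ψ : MatroidAut M) (F : FixedFlat ψ) :
    signedTrace ψ F = mobiusFix ψ (emptyFlat ψ) F := by
  classical
  let _ : LocallyFiniteOrder (FixedFlat ψ) := Fintype.toLocallyFiniteOrder
  have h := eq_mu_of_sum_eq (b := emptyFlat ψ) (fun F => Set.empty_subset F.1)
    (fun G => by convert sum_signedTrace_le ψ G) F
  rw [h, mobiusFix]
  congr!

end Trace

/-! ### Comparison with the framing groups of the fan. -/

section Framing

variable {E : Type*} {M : Matroid E} {F G H : Set E} {p : ℕ}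

open ExteriorAlgebra (ι ιMulti)

theorem ιMulti_mem_flagSpan {F : Fin p → Set E} (hF : ∀ i, M.IsFlat (F i)) (hG : ∀ i, F i ⊆ G)
    (hanti : Antitone F) : ιMulti ℝ p (fun i => ind (F i)) ∈ flagSpan M p G := by
  induction p generalizing G with
  | zero =>
    rw [ExteriorAlgebra.ιMulti_zero_apply]
    exact one_mem_flagSpan
  | succ p ih =>
    rw [ExteriorAlgebra.ιMulti_succ_apply]
    exact ι_mul_mem_flagSpan (hF 0) (hG 0) (ih (F := fun i => F i.succ) (fun i => hF _)
      (fun i => hanti (Fin.zero_le _)) fun i j h => hanti (Fin.succ_le_succ_iff.2 h))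

theorem flagSpan_le_of_ιMulti_mem {N : Submodule ℝ (ExteriorAlgebra ℝ (E → ℝ))}
    (h : ∀ F : Fin p → Set E, (∀ i, M.IsFlat (F i)) → (∀ i, F i ⊆ G) → Antitone F →
      ιMulti ℝ p (fun i => ind (F i)) ∈ N) : flagSpan M p G ≤ N := by
  induction p generalizing G N with
  | zero =>
    refine flagSpan_zero_le ?_
    simpa using h Fin.elim0 (fun i => i.elim0) (fun i => i.elim0) fun i => i.elim0
  | succ p ih =>
    refine flagSpan_succ_le fun H hH hHG y hy => ?_
    suffices hs : flagSpan M p H ≤ N.comap (LinearMap.mulLeft ℝ (ι ℝ (ind H))) from hs hy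
    refine ih fun F hF hFH hanti => ?_
    have := h (Fin.cons H F) (Fin.cases hH hF) (Fin.cases hHG fun i => (hFH i).trans hHG) ?_
    · rwa [ExteriorAlgebra.ιMulti_succ_apply] at this
    · intro i j
      refine Fin.cases ?_ (fun i => ?_) i <;> refine Fin.cases ?_ (fun j => ?_) j
      · exact fun _ => le_rfl
      · exact fun _ => hFH j
      · exact fun h => absurd h (by simp)
      · exact fun h => hanti (Fin.succ_le_succ_iff.1 h)

theorem ιMulti_mem_flagSpan_of_isChain [Finite E] {C : Set (Set E)} (hC : IsChain (· ⊆ ·) C)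
    (hflat : ∀ F ∈ C, M.IsFlat F) (hG : ∀ F ∈ C, F ⊆ G) {F : Fin p → Set E} (hF : ∀ i, F i ∈ C) :
    ιMulti ℝ p (fun i => ind (F i)) ∈ flagSpan M p G := by
  -- Members of a chain are ordered by cardinality, so sorting by decreasing size yields a flag and
  -- changes the wedge only by a sign.
  set σ := Tuple.sort fun i => OrderDual.toDual (F i).ncard
  have hanti : Antitone (F ∘ σ) := fun i j hij => by
    have hcard : (F (σ j)).ncard ≤ (F (σ i)).ncard :=
      Tuple.monotone_sort (fun i => OrderDual.toDual (F i).ncard) hij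
    rcases hC.total (hF (σ j)) (hF (σ i)) with h | h
    · exact h
    · exact (Set.eq_of_subset_of_ncard_le h hcard (Set.toFinite _)).ge
  have h := ιMulti_mem_flagSpan (M := M) (fun i => hflat _ (hF (σ i)))
    (fun i => hG _ (hF (σ i))) hanti
  have hperm := (ιMulti ℝ p).map_perm (fun i => ind (F i)) σ
  change ιMulti ℝ p (fun i => ind (F (σ i))) = _ at hperm
  rw [hperm] at h
  rcases Int.units_eq_one_or (Equiv.Perm.sign σ) with hs | hs
  · rwa [hs, one_smul] at h
  · rw [hs] at h
    simpa using h

theorem ιMulti_mem_span_ιMulti {V : Type*} [AddCommGroup V] [Module ℝ V] {X : Set V}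
    {v : Fin p → V} (hv : ∀ i, v i ∈ Submodule.span ℝ X) :
    ιMulti ℝ p v ∈ Submodule.span ℝ (ιMulti ℝ p '' {u | ∀ i, u i ∈ X}) := by
  have h : ιMulti ℝ p v ∈ Submodule.span ℝ (ι ℝ '' X) ^ p := by
    induction p with
    | zero => simp
    | succ p ih =>
      rw [ExteriorAlgebra.ιMulti_succ_apply, pow_succ']
      refine Submodule.mul_mem_mul ?_ (ih fun i => hv _)
      rw [Submodule.span_image]
      exact ⟨v 0, hv 0, rfl⟩
  rw [Submodule.span_pow] at h
  refine Submodule.span_mono ?_ h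
  intro x hx
  obtain ⟨f, rfl⟩ := Set.mem_pow.1 hx
  choose u hu hf using fun i => (f i).2
  refine ⟨u, hu, ?_⟩
  rw [ExteriorAlgebra.ιMulti_apply]
  simp only [hf]

/-- The map `⋀ ℝ^E → ⋀ (ℝ^E / ℝ𝟏)` induced by the projection. -/
noncomputable def projMap (E : Type*) :
    ExteriorAlgebra ℝ (E → ℝ) →ₐ[ℝ] ExteriorAlgebra ℝ (ProjSpace E) :=
  ExteriorAlgebra.map (Submodule.mkQ _)

/-- The section `v ↦ v - v(e)𝟏` of the projection `ℝ^E → ℝ^E / ℝ𝟏`. -/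
noncomputable def projSection (e : E) : ProjSpace E →ₗ[ℝ] (E → ℝ) :=
  Submodule.liftQ _ (LinearMap.id - (LinearMap.proj e).smulRight (1 : E → ℝ)) (by
    rw [Submodule.span_singleton_le_iff_mem]
    simp)

theorem projSection_mkQ (e : E) (v : E → ℝ) :
    projSection e (Submodule.mkQ _ v) = v - v e • (1 : E → ℝ) := rfl

theorem mkQ_projSection (e : E) (w : ProjSpace E) :
    Submodule.mkQ _ (projSection e w) = w := by
  obtain ⟨v, rfl⟩ := Submodule.mkQ_surjective _ w
  rw [projSection_mkQ, map_sub, map_smul, sub_eq_self]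
  have : Submodule.mkQ (Submodule.span ℝ {(1 : E → ℝ)}) 1 = 0 := by
    rw [Submodule.mkQ_apply, Submodule.Quotient.mk_eq_zero]
    exact Submodule.mem_span_singleton_self _
  rw [this, smul_zero]

theorem projMap_map_projSection (e : E) (y : ExteriorAlgebra ℝ (ProjSpace E)) :
    projMap E (ExteriorAlgebra.map (projSection e) y) = y := by
  suffices h : (projMap E).comp (ExteriorAlgebra.map (projSection e)) = AlgHom.id ℝ _ from
    DFunLike.congr_fun h y
  refine ExteriorAlgebra.hom_ext (LinearMap.ext fun w => ?_)
  simp only [projMap, AlgHom.comp_toLinearMap, LinearMap.comp_apply,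
    AlgHom.toLinearMap_apply, ExteriorAlgebra.map_apply_ι, mkQ_projSection, AlgHom.id_apply]

theorem ind_univ : ind (Set.univ : Set E) = 1 :=
  Set.indicator_univ _

/-- Both sides extend `v ↦ v - v(e)𝟏` multiplicatively; for the right side this uses `𝟏 ∧ 𝟏 = 0`.
This identifies the quotient by `𝟏` with the Koszul homotopy at `G = E`. -/
theorem map_projSection_projMap (e : E) (x : ExteriorAlgebra ℝ (E → ℝ)) :
    ExteriorAlgebra.map (projSection e) (projMap E x) =
      CliffordAlgebra.contractLeft (LinearMap.proj e : Module.Dual ℝ (E → ℝ))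
        (ι ℝ (ind Set.univ) * x) := by
  induction x using CliffordAlgebra.left_induction with
  | algebraMap r =>
    rw [AlgHom.commutes, AlgHom.commutes, CliffordAlgebra.contractLeft_mul_algebraMap,
      CliffordAlgebra.contractLeft_ι]
    simp [ind_univ]
  | add x y hx hy => rw [map_add, map_add, hx, hy, mul_add, map_add]
  | ι_mul x v hx =>
    have hι : ExteriorAlgebra.map (projSection e) (projMap E (ι ℝ v)) =
        ι ℝ v - v e • ι ℝ (ind Set.univ) := by
      rw [projMap, ExteriorAlgebra.map_apply_ι, ExteriorAlgebra.map_apply_ι, projSection_mkQ,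
        map_sub, map_smul, ind_univ]
    have hswap : ι ℝ v * ι ℝ (ind Set.univ) = -(ι ℝ (ind Set.univ) * ι ℝ v) :=
      eq_neg_of_add_eq_zero_left (ExteriorAlgebra.ι_add_mul_swap _ _)
    have hsq : ι ℝ (ind Set.univ) * ι ℝ (ind Set.univ : E → ℝ) = 0 := ExteriorAlgebra.ι_sq_zero _
    rw [map_mul, map_mul, hx, hι]
    simp only [CliffordAlgebra.contractLeft_ι_mul, LinearMap.proj_apply, ind_univ,
      Pi.one_apply, one_smul] at hswap hsq ⊢
    simp only [sub_mul, mul_sub, smul_mul_assoc, mul_smul_comm, ← mul_assoc, hswap, hsq,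
      neg_mul, smul_zero, sub_zero]
    abel

theorem indicatorVec_eq_zero {S : Set E} (h : S = ∅ ∨ S = Set.univ) :
    indicatorVec S = 0 := by
  rw [indicatorVec, Submodule.Quotient.mk_eq_zero]
  rcases h with rfl | rfl
  · rw [Set.indicator_empty]
    exact Submodule.zero_mem _
  · rw [Set.indicator_univ]
    exact Submodule.mem_span_singleton_self _

theorem projMap_ιMulti_ind (F : Fin p → Set E) :
    projMap E (ιMulti ℝ p fun i => ind (F i)) = ιMulti ℝ p fun i => indicatorVec (F i) :=
  ExteriorAlgebra.map_apply_ιMulti _ _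

theorem map_subtype_framingGroup (M : Matroid E) (p : ℕ) :
    (framingGroup M p).map (Submodule.subtype _) =
      Submodule.span ℝ {w | ∃ C, IsFlatChain M C ∧ ∃ v : Fin p → ProjSpace E,
        (∀ i, v i ∈ chainCone C) ∧ w = ιMulti ℝ p v} := by
  rw [framingGroup, Submodule.map_span]
  congr 1
  ext w
  constructor
  · rintro ⟨_, ⟨_, ⟨C, hC, rfl⟩, v, hv, rfl⟩, rfl⟩
    exact ⟨C, hC, v, hv, rfl⟩
  · rintro ⟨C, hC, v, hv, rfl⟩
    exact ⟨_, ⟨_, ⟨C, hC, rfl⟩, v, hv, rfl⟩, rfl⟩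

theorem projMap_mem_framingGroup (hE : M.E = Set.univ) {x : ExteriorAlgebra ℝ (E → ℝ)}
    (hx : x ∈ flagSpan M p Set.univ) :
    projMap E x ∈ (framingGroup M p).map (Submodule.subtype _) := by
  suffices h : flagSpan M p Set.univ ≤
      ((framingGroup M p).map (Submodule.subtype _)).comap (projMap E).toLinearMap from h hx
  rw [map_subtype_framingGroup]
  refine flagSpan_le_of_ιMulti_mem fun F hF _ hanti => ?_
  rw [Submodule.mem_comap, AlgHom.toLinearMap_apply, projMap_ιMulti_ind]
  -- Flags may contain `∅` or `E`, which chains of the fan exclude, but both have zero class modulo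
  -- `𝟏`.
  by_cases hdeg : ∃ i, F i = ∅ ∨ F i = Set.univ
  · obtain ⟨i, hi⟩ := hdeg
    rw [(ιMulti ℝ p).map_coord_zero i (indicatorVec_eq_zero hi)]
    exact Submodule.zero_mem _
  push Not at hdeg
  refine Submodule.subset_span ⟨Set.range F, ⟨?_, ?_, ?_, ?_⟩, _, fun i => ?_, rfl⟩
  · rintro _ ⟨i, rfl⟩
    exact hF i
  · rintro _ ⟨i, rfl⟩
    exact (hdeg i).1.ne_empty
  · rintro _ ⟨i, rfl⟩
    rw [hE]
    exact (hdeg i).2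
  · rintro _ ⟨i, rfl⟩ _ ⟨j, rfl⟩ -
    exact (le_total j i).imp (fun h => hanti h) fun h => hanti h
  · exact Submodule.subset_span ⟨_, ⟨i, rfl⟩, rfl⟩

theorem chainCone_le_span (C : Set (Set E)) {w : ProjSpace E} (hw : w ∈ chainCone C) :
    w ∈ Submodule.span ℝ (indicatorVec '' C) := by
  suffices h : chainCone C ≤
      (Submodule.span ℝ (indicatorVec '' C)).restrictScalars {c : ℝ // 0 ≤ c} from h hw
  exact Submodule.span_le.2 Submodule.subset_span

theorem map_projSection_mem_flagSpan [Finite E] (hE : M.E = Set.univ) (e : E)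
    {y : ExteriorAlgebra ℝ (ProjSpace E)}
    (hy : y ∈ (framingGroup M p).map (Submodule.subtype _)) :
    ExteriorAlgebra.map (projSection e) y ∈ flagSpan M p Set.univ := by
  suffices h : (framingGroup M p).map (Submodule.subtype _) ≤
      (flagSpan M p Set.univ).comap (ExteriorAlgebra.map (projSection e)).toLinearMap from h hy
  rw [map_subtype_framingGroup, Submodule.span_le]
  rintro _ ⟨C, hC, v, hv, rfl⟩
  have hle : Submodule.span ℝ (ιMulti ℝ p '' {u | ∀ i, u i ∈ indicatorVec '' C}) ≤
      (flagSpan M p Set.univ).comap (ExteriorAlgebra.map (projSection e)).toLinearMap := by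
    refine Submodule.span_le.2 ?_
    rintro _ ⟨u, hu, rfl⟩
    choose F hF hFu using hu
    obtain rfl : (fun i => indicatorVec (F i)) = u := funext hFu
    change ExteriorAlgebra.map (projSection e) (ιMulti ℝ p fun i => indicatorVec (F i)) ∈
      flagSpan M p Set.univ
    -- The section does not send `v_F` to an indicator vector in general, but its value is a
    -- contraction of `𝟏 ∧ v_{F_1} ∧ ⋯ ∧ v_{F_p}`, and `flagSpan` is stable under contraction.
    rw [← projMap_ιMulti_ind, map_projSection_projMap]
    exact contractLeft_mem_flagSpan _ (ι_mul_mem_flagSpan (hE ▸ M.ground_isFlat) subset_rfl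
      (ιMulti_mem_flagSpan_of_isChain hC.isChain hC.isFlat (fun F _ => Set.subset_univ F) hF))
  exact hle (ιMulti_mem_span_ιMulti fun i => chainCone_le_span C (hv i))

/-- The ground set as a fixed flat. -/
abbrev groundFlat (hE : M.E = Set.univ) (ψ : MatroidAut M) : FixedFlat ψ :=
  ⟨Set.univ, hE ▸ M.ground_isFlat, Set.image_univ_of_surjective ψ.toEquiv.surjective⟩

/-- The surjection from the span of flags onto the framing group. -/
noncomputable def flagToFraming (hE : M.E = Set.univ) (p : ℕ) :
    flagSpan M p Set.univ →ₗ[ℝ] framingGroup M p :=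
  (Submodule.equivSubtypeMap _ (framingGroup M p)).symm.toLinearMap ∘ₗ
    (projMap E).toLinearMap.restrict fun _ hx => projMap_mem_framingGroup hE hx

/-- The section of `flagToFraming` given by a coordinate. -/
noncomputable def framingToFlag [Finite E] (hE : M.E = Set.univ) (p : ℕ) (e : E) :
    framingGroup M p →ₗ[ℝ] flagSpan M p Set.univ :=
  (ExteriorAlgebra.map (projSection e)).toLinearMap.restrict
      (fun _ hy => map_projSection_mem_flagSpan hE e hy) ∘ₗ
    (Submodule.equivSubtypeMap _ (framingGroup M p)).toLinearMap

theorem coe_flagToFraming (hE : M.E = Set.univ) (x : flagSpan M p Set.univ) :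
    ((flagToFraming hE p x : ⋀[ℝ]^p (ProjSpace E)) : ExteriorAlgebra ℝ (ProjSpace E)) =
      projMap E x :=
  congrArg Subtype.val ((Submodule.equivSubtypeMap _ (framingGroup M p)).apply_symm_apply
    ⟨projMap E x, projMap_mem_framingGroup hE x.2⟩)

theorem coe_framingToFlag [Finite E] (hE : M.E = Set.univ) (e : E) (w : framingGroup M p) :
    (framingToFlag hE p e w : ExteriorAlgebra ℝ (E → ℝ)) =
      ExteriorAlgebra.map (projSection e) (w : ⋀[ℝ]^p (ProjSpace E)).1 :=
  rfl

theorem coe_exteriorPower_map {V W : Type*} [AddCommGroup V] [Module ℝ V] [AddCommGroup W]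
    [Module ℝ W] (f : V →ₗ[ℝ] W) (w : ⋀[ℝ]^p V) :
    (exteriorPower.map p f w : ExteriorAlgebra ℝ W) = ExteriorAlgebra.map f w := by
  suffices h : Submodule.subtype _ ∘ₗ exteriorPower.map p f =
      (ExteriorAlgebra.map f).toLinearMap ∘ₗ Submodule.subtype _ from LinearMap.congr_fun h w
  refine exteriorPower.linearMap_ext (AlternatingMap.ext fun v => ?_)
  simp [exteriorPower.map_apply_ιMulti, ExteriorAlgebra.map_apply_ιMulti]

theorem map_ambientMap_projMap (ψ : E ≃ E) (x : ExteriorAlgebra ℝ (E → ℝ)) :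
    ExteriorAlgebra.map (ambientMap ψ) (projMap E x) = projMap E (permMap ψ x) := by
  suffices h : (ExteriorAlgebra.map (ambientMap ψ)).comp (projMap E) =
      (projMap E).comp (permMap ψ) from DFunLike.congr_fun h x
  refine ExteriorAlgebra.hom_ext (LinearMap.ext fun v => ?_)
  simp only [projMap, permMap, AlgHom.comp_toLinearMap, LinearMap.comp_apply,
    AlgHom.toLinearMap_apply, ExteriorAlgebra.map_apply_ι]
  rfl

instance : Module.Free ℝ (framingGroup M p) :=
  Module.Free.of_equiv (Submodule.equivSubtypeMap _ (framingGroup M p)).symm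

/-- Write `q` for the projection and `s` for its section. Since `q s = 1` and `q` is equivariant,
`Tr Ψ_* = Tr (q ψ s) = Tr (ψ s q)`, and `s q` is wedging with `𝟏` followed by contraction. -/
theorem trace_framingMap [Finite E] (hE : M.E = Set.univ) (ψ : MatroidAut M) (p : ℕ) (e : E) :
    LinearMap.trace ℝ (framingGroup M p) (framingMap hE ψ p) =
      LinearMap.trace ℝ _ (flagEnd ψ p (groundFlat hE ψ) ∘ₗ
        flagContract (LinearMap.proj e) M p Set.univ ∘ₗ
          flagWedge (groundFlat hE ψ).2.1 p) := by
  have hqs : flagToFraming hE p ∘ₗ framingToFlag hE p e = LinearMap.id := by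
    refine LinearMap.ext fun w => Subtype.ext (Subtype.ext ?_)
    rw [LinearMap.comp_apply, coe_flagToFraming, coe_framingToFlag, projMap_map_projSection]
    rfl
  have hsq : framingToFlag hE p e ∘ₗ flagToFraming hE p =
      flagContract (LinearMap.proj e) M p Set.univ ∘ₗ flagWedge (groundFlat hE ψ).2.1 p := by
    refine LinearMap.ext fun x => Subtype.ext ?_
    rw [LinearMap.comp_apply, coe_framingToFlag, coe_flagToFraming, map_projSection_projMap]
    rfl
  have hcomm : framingMap hE ψ p ∘ₗ flagToFraming hE p =
      flagToFraming hE p ∘ₗ flagEnd ψ p (groundFlat hE ψ) := by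
    refine LinearMap.ext fun x => Subtype.ext (Subtype.ext ?_)
    change (exteriorPower.map p (ambientMap ψ.toEquiv) (flagToFraming hE p x).1 :
      ExteriorAlgebra ℝ (ProjSpace E)) = _
    rw [coe_exteriorPower_map, coe_flagToFraming, map_ambientMap_projMap, LinearMap.comp_apply,
      coe_flagToFraming]
    rfl
  have h : framingMap hE ψ p =
      (framingMap hE ψ p ∘ₗ flagToFraming hE p) ∘ₗ framingToFlag hE p e := by
    rw [LinearMap.comp_assoc, hqs, LinearMap.comp_id]
  rw [h, hcomm, LinearMap.comp_assoc, ← hsq]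
  exact LinearMap.trace_comp_comm' (R := ℝ) (M := framingGroup M p) (N := flagSpan M p Set.univ)
    (flagEnd ψ p (groundFlat hE ψ) ∘ₗ framingToFlag hE p e) (flagToFraming hE p)

end Framing

end MatroidFan

theorem lemma4p4 {E : Type*} [Finite E] (M : Matroid E) [M.Loopless] (hE : M.E = Set.univ)
    (n : ℕ) (hrank : M.eRank = (n + 1 : ℕ)) (ψ : MatroidFan.MatroidAut M)
    (p : ℕ) (hp : p ≤ n) :
    (-1 : ℝ) ^ p *
        LinearMap.trace ℝ (MatroidFan.framingGroup M p) (MatroidFan.framingMap hE ψ p) =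
      ∑ F : MatroidFan.FixedFlat ψ with M.eRk F.1 ≤ p,
        (MatroidFan.mobiusFix ψ (MatroidFan.emptyFlat ψ) F : ℝ) := by
  classical
  -- The rank `n + 1` is positive, so there is a coordinate to contract with.
  obtain ⟨e⟩ : Nonempty E := by
    by_contra hempty
    rw [not_nonempty_iff] at hempty
    have h := M.eRk_ground
    rw [Set.eq_empty_of_isEmpty M.E, M.eRk_empty, hrank] at h
    exact absurd h.symm (by exact_mod_cast Nat.succ_ne_zero n)
  rw [MatroidFan.trace_framingMap hE ψ p e]
  refine (MatroidFan.sum_range_flagTrace ψ p (MatroidFan.groundFlat hE ψ) _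
    (MatroidFan.ind_apply_of_mem (Set.mem_univ e))).symm.trans ?_
  rw [← MatroidFan.sum_signedTrace]
  refine Finset.sum_congr (Finset.filter_congr fun F _ => ?_) fun F _ =>
    MatroidFan.signedTrace_eq_mobiusFix ψ F
  exact and_iff_right (Set.subset_univ F.1)
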